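/- Let $k$ be a field and let $G$ be a finite simple graph on $n$ vertices $x_1,\dots,x_n$. Let $\widetilde G$ be its whiskering, the graph with vertex set $\{x_1,\dots,x_n,y_1,\dots,y_n\}$ and edge set $E(G)\cup\{\{x_i,y_i\} : 1\le i\le n\}$. Identify the vertices of $\widetilde G$ with the variables of $R=k[x_1,\dots,x_n,y_1,\dots,y_n]$, let $\mathfrak m$ be the ideal generated by all the variables, and let $$J(\widetilde G)=\bigcap_{\{u,v\}\in E(\widetilde G)}(u,v)\subseteq R$$ be the cover ideal of $\widetilde G$. Then the analytic spread of $J(\widetilde G)$, that is, the Krull dimension $l(J(\widetilde G))$ of the fiber cone $F(J(\widetilde G))=\bigoplus_{i\ge 0} J(\widetilde G)^i/\mathfrak m J(\widetilde G)^i$, satisfies $$l(J(\widetilde G))=n+1.$$ -/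

import Mathlib

open MvPolynomial

noncomputable section

/-- The whiskering of a graph `G` on `V`: the vertex set is `V ⊕ V`, where `Sum.inl i` is the
original vertex `x_i` and `Sum.inr i` is the new vertex `y_i`; the edges are the edges of `G`
together with the whiskers `{x_i, y_i}`. -/
def whiskering {V : Type*} (G : SimpleGraph V) : SimpleGraph (V ⊕ V) where
  Adj
    | Sum.inl u, Sum.inl v => G.Adj u v
    | Sum.inl u, Sum.inr v => u = v
    | Sum.inr u, Sum.inl v => u = v
    | Sum.inr _, Sum.inr _ => False
  symm := ⟨by
    rintro (u | u) (v | v) h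
    · exact G.adj_symm h
    · exact Eq.symm h
    · exact Eq.symm h
    · exact h⟩
  loopless := ⟨by
    rintro (u | u) h
    · exact G.irrefl h
    · exact h⟩

/-- The cover ideal `J(G) = ⋂_{{i, j} ∈ E(G)} (x_i, x_j)` in the polynomial ring over `k` whose
variables are the vertices of `G`. -/
def coverIdeal (k : Type*) [Field k] {V : Type*} (G : SimpleGraph V) :
    Ideal (MvPolynomial V k) :=
  ⨅ (i : V) (j : V) (_ : G.Adj i j), Ideal.span {X i, X j}

/-- The ideal `⨁ᵢ 𝔪 Iⁱ tⁱ` of the Rees algebra `⨁ᵢ Iⁱ tⁱ`, where `𝔪 = idealOfVars σ k` is the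
homogeneous maximal ideal, generated by all the variables. -/
def fiberIdeal {k : Type*} [Field k] {σ : Type*} (I : Ideal (MvPolynomial σ k)) :
    Ideal (reesAlgebra I) where
  carrier := {f | ∀ i : ℕ, (f : Polynomial (MvPolynomial σ k)).coeff i ∈
    idealOfVars σ k * I ^ i}
  zero_mem' _ := Ideal.zero_mem _
  add_mem' hf hg i := by
    simpa using Ideal.add_mem _ (hf i) (hg i)
  smul_mem' c f hf i := by
    have hc := c.2
    rw [smul_eq_mul, Subalgebra.coe_mul, Polynomial.coeff_mul]
    refine Ideal.sum_mem _ fun p hp => ?_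
    rw [← Finset.HasAntidiagonal.mem_antidiagonal.mp hp, pow_add, mul_left_comm]
    exact Ideal.mul_mem_mul (hc p.1) (hf p.2)

/-- The fiber cone `F(I) = ⨁ᵢ Iⁱ / 𝔪 Iⁱ`, as the quotient of the Rees algebra `⨁ᵢ Iⁱ tⁱ` by its
ideal `⨁ᵢ 𝔪 Iⁱ tⁱ`. -/
abbrev fiberCone {k : Type*} [Field k] {σ : Type*} (I : Ideal (MvPolynomial σ k)) : Type _ :=
  reesAlgebra I ⧸ fiberIdeal I

/-- The analytic spread `l(I)`: the Krull dimension of the fiber cone of `I`. -/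
def analyticSpread {k : Type*} [Field k] {σ : Type*} (I : Ideal (MvPolynomial σ k)) :
    WithBot ℕ∞ :=
  ringKrullDim (fiberCone I)

end

/-! `J` is generated by the monomials `m_C = ∏_{i ∈ C} x_i ∏_{i ∉ C} y_i`, with `C` a vertex cover
of `G`. All have degree `n`, so the fiber cone is the toric ring `k[m_C t]`
(`fiberPresentation_eq_zero_iff`, `fiberPresentation_surjective`). Setting `a_i = x_i / y_i` and `T
= t ∏ y_i` turns it into `k[T ∏_{i ∈ C} a_i]`, a finitely generated domain, whose dimension is its
transcendence degree. The covers `V` and `V ∖ {i}` already recover every `a_i` and `T` as fractions,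
so this degree is `n + 1`. -/

/-- By Noether normalization `A` is integral over a polynomial ring, whose number of variables must
be the transcendence degree. Incomparability bounds the dimension above; lying over and going up
lift chains of primes. -/
theorem ringKrullDim_eq_of_trdeg_eq (k A : Type*) [Field k] [CommRing A] [IsDomain A]
    [Algebra k A] [Algebra.FiniteType k A] {n : ℕ} (h : Algebra.trdeg k A = n) :
    ringKrullDim A = n := by
  obtain ⟨s, g, hg, hint⟩ := exists_integral_inj_algHom_of_fg k A
  algebraize [g.toRingHom]
  have : IsScalarTower k (MvPolynomial (Fin s) k) A :=
    .of_algebraMap_eq fun x => (g.commutes x).symm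
  have hinj : Function.Injective (algebraMap (MvPolynomial (Fin s) k) A) := hg
  have : FaithfulSMul (MvPolynomial (Fin s) k) A :=
    (faithfulSMul_iff_algebraMap_injective _ _).mpr hinj
  have : Algebra.IsIntegral (MvPolynomial (Fin s) k) A := ⟨hint⟩
  have hs : s = n := by
    have := lift_trdeg_add_eq k (MvPolynomial (Fin s) k) A
    rw [h, MvPolynomial.trdeg_of_isDomain, trdeg_eq_zero] at this
    simpa using this
  subst hs
  have hdim : ringKrullDim (MvPolynomial (Fin s) k) = s := by simp
  rw [← hdim]
  apply le_antisymm
  · exact Order.krullDim_le_of_strictMono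
      (PrimeSpectrum.comap (algebraMap (MvPolynomial (Fin s) k) A))
      fun P Q hPQ => Ideal.IsIntegral.comap_lt_comap hPQ
  · refine iSup_le fun l => ?_
    obtain ⟨P, _, hP⟩ := Ideal.exists_ideal_over_prime_of_isIntegral_of_isDomain
      (S := A) l.head.asIdeal (by rw [(RingHom.injective_iff_ker_eq_bot _).mp hinj]; exact bot_le)
    have : P.LiesOver l.head.asIdeal := ⟨hP.symm⟩
    obtain ⟨L, hL, -⟩ := Ideal.exists_ltSeries_of_hasGoingUp l P
    rw [← hL]
    exact le_iSup (fun L : LTSeries (PrimeSpectrum A) => (L.length : WithBot ℕ∞)) L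

theorem MvPolynomial.IsHomogeneous.eq_zero_of_mem_pow_idealOfVars {σ R : Type*} [CommRing R]
    {p : MvPolynomial σ R} {d e : ℕ} (hp : p.IsHomogeneous d) (hde : d < e)
    (h : p ∈ idealOfVars σ R ^ e) : p = 0 := by
  ext x
  by_cases hx : Finsupp.degree x = d
  · exact (mem_pow_idealOfVars_iff' _ _).mp h x (hx ▸ hde)
  · exact hp.coeff_eq_zero hx

/-! ### Monomial generators of the cover ideal -/

section Whiskering

variable (k : Type*) [Field k] {V : Type*} [Fintype V] (G : SimpleGraph V)

/-- The vertex covers of `G`. -/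
abbrev VertexCover : Type _ := {C : Finset V // G.IsVertexCover (C : Set V)}

open Classical in
/-- The monomial `∏_{i ∈ C} x_i ∏_{i ∉ C} y_i`. -/
noncomputable def whiskerMonomial (C : Finset V) : MvPolynomial (V ⊕ V) k :=
  ∏ i, if i ∈ C then X (Sum.inl i) else X (Sum.inr i)

variable {k G} in
theorem isHomogeneous_whiskerMonomial (C : Finset V) :
    (whiskerMonomial k C).IsHomogeneous (Fintype.card V) := by
  classical
  have := IsHomogeneous.prod Finset.univ
    (fun i => if i ∈ C then (X (Sum.inl i) : MvPolynomial (V ⊕ V) k) else X (Sum.inr i))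
    (fun _ => 1) fun i _ => by split_ifs <;> exact isHomogeneous_X _ _
  simpa [whiskerMonomial] using this

theorem mem_coverIdeal_iff {W : Type*} (H : SimpleGraph W) (p : MvPolynomial W k) :
    p ∈ coverIdeal k H ↔ ∀ m ∈ p.support, ∀ i j, H.Adj i j → m i ≠ 0 ∨ m j ≠ 0 := by
  have h (i j : W) : p ∈ Ideal.span {X i, X j} ↔ ∀ m ∈ p.support, m i ≠ 0 ∨ m j ≠ 0 := by
    have := mem_ideal_span_X_image (x := p) (s := {i, j})
    rw [Set.image_pair] at this
    simpa using this
  simp only [coverIdeal, Submodule.mem_iInf, h]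
  exact ⟨fun H m hm i j hij => H i j hij m hm, fun H i j hij m hm => H m hm i j hij⟩

theorem whiskerMonomial_mem_coverIdeal (C : VertexCover G) :
    whiskerMonomial k C.1 ∈ coverIdeal k (whiskering G) := by
  classical
  have hdvd (i : V) : (if i ∈ C.1 then X (Sum.inl i) else X (Sum.inr i)) ∣
      whiskerMonomial k C.1 := Finset.dvd_prod_of_mem _ (Finset.mem_univ i)
  have hl {i : V} (hi : i ∈ C.1) : X (Sum.inl i) ∣ whiskerMonomial k C.1 := by
    simpa [hi] using hdvd i
  have hw (i : V) : whiskerMonomial k C.1 ∈ Ideal.span {X (Sum.inl i), X (Sum.inr i)} := by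
    refine Ideal.mem_of_dvd _ (hdvd i) (Ideal.subset_span ?_)
    split_ifs <;> simp
  simp only [coverIdeal, Submodule.mem_iInf]
  rintro (i | i) (j | j) h
  · rcases C.2 h with hi | hj
    · exact Ideal.mem_of_dvd _ (hl hi) (Ideal.subset_span (by simp))
    · exact Ideal.mem_of_dvd _ (hl hj) (Ideal.subset_span (by simp))
  · obtain rfl : i = j := h
    exact hw i
  · obtain rfl : i = j := h
    rw [Set.pair_comm]
    exact hw i
  · exact h.elim

theorem coverIdeal_whiskering_eq_span :
    coverIdeal k (whiskering G) =
      Ideal.span (Set.range fun C : VertexCover G => whiskerMonomial k C.1) := by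
  classical
  apply le_antisymm
  · intro p hp
    rw [mem_coverIdeal_iff] at hp
    rw [p.as_sum]
    refine Ideal.sum_mem _ fun m hm => ?_
    have hm := hp m hm
    -- The `x`-support of a monomial of `J` is a cover of `G`; for `i` outside it, the whisker at
    -- `i` forces `y_i` to divide the monomial.
    let C : VertexCover G := ⟨Finset.univ.filter fun i => m (Sum.inl i) ≠ 0, fun i j hij => by
      simpa using hm (Sum.inl i) (Sum.inl j) hij⟩
    refine Ideal.mem_of_dvd _ ?_ (Ideal.subset_span ⟨C, rfl⟩)
    rw [monomial_eq, Finsupp.prod_fintype _ _ fun _ => pow_zero _, Fintype.prod_sum_type,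
      ← Finset.prod_mul_distrib]
    refine Dvd.dvd.mul_left (Finset.prod_dvd_prod_of_dvd _ _ fun i _ => ?_) _
    split_ifs with h
    · exact (dvd_pow_self _ (by simpa [C] using h)).mul_right _
    · refine (dvd_pow_self _ ?_).mul_left _
      have := hm (Sum.inl i) (Sum.inr i) rfl
      simp only [C, Finset.mem_filter, Finset.mem_univ, true_and] at h
      tauto
  · rw [Ideal.span_le]
    rintro _ ⟨C, rfl⟩
    exact whiskerMonomial_mem_coverIdeal k G C

theorem coverIdeal_whiskering_le :
    coverIdeal k (whiskering G) ≤ idealOfVars (V ⊕ V) k ^ Fintype.card V := by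
  rw [coverIdeal_whiskering_eq_span, Ideal.span_le]
  rintro _ ⟨C, rfl⟩
  refine (mem_pow_idealOfVars_iff' _ _).mpr fun x hx => ?_
  exact (isHomogeneous_whiskerMonomial C.1).coeff_eq_zero hx.ne

/-! ### The fiber cone as a toric ring -/

/-- The map `z_C ↦ m_C t` into `R[t]`, whose image lies in the Rees algebra. -/
noncomputable def reesPresentation :
    MvPolynomial (VertexCover G) k →ₐ[k] Polynomial (MvPolynomial (V ⊕ V) k) :=
  aeval fun C => Polynomial.monomial 1 (whiskerMonomial k C.1)

theorem reesPresentation_mem (p : MvPolynomial (VertexCover G) k) :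
    reesPresentation k G p ∈ reesAlgebra (coverIdeal k (whiskering G)) := by
  induction p using MvPolynomial.induction_on with
  | C a =>
    rw [← algebraMap_eq, AlgHom.commutes]
    exact ((reesAlgebra (coverIdeal k (whiskering G))).restrictScalars k).algebraMap_mem a
  | add p q hp hq => rw [map_add]; exact add_mem hp hq
  | mul_X p C hp =>
    rw [map_mul]
    refine mul_mem hp ?_
    rw [reesPresentation, aeval_X, reesAlgebra.monomial_mem, pow_one]
    exact whiskerMonomial_mem_coverIdeal k G C

theorem isHomogeneous_coeff_reesPresentation (p : MvPolynomial (VertexCover G) k) (j : ℕ) :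
    ((reesPresentation k G p).coeff j).IsHomogeneous (Fintype.card V * j) := by
  induction p using MvPolynomial.induction_on generalizing j with
  | C a =>
    rw [← algebraMap_eq, AlgHom.commutes, IsScalarTower.algebraMap_apply k
      (MvPolynomial (V ⊕ V) k), Polynomial.algebraMap_eq, Polynomial.coeff_C]
    split_ifs with h
    · subst h
      exact isHomogeneous_C _ a
    · exact isHomogeneous_zero _ _ _
  | add p q hp hq => rw [map_add, Polynomial.coeff_add]; exact (hp j).add (hq j)
  | mul_X p C hp =>
    rw [map_mul, reesPresentation, aeval_X, ← Polynomial.C_mul_X_pow_eq_monomial, pow_one,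
      ← mul_assoc]
    cases j with
    | zero => rw [Polynomial.coeff_mul_X_zero]; exact isHomogeneous_zero _ _ _
    | succ j =>
      rw [Polynomial.coeff_mul_X, Polynomial.coeff_mul_C, mul_add_one]
      exact (hp j).mul (isHomogeneous_whiskerMonomial C.1)

/-- The presentation of the fiber cone sending `z_C` to the class of `m_C t`. -/
noncomputable def fiberPresentation :
    MvPolynomial (VertexCover G) k →+* fiberCone (coverIdeal k (whiskering G)) :=
  (Ideal.Quotient.mk _).comp
    ((reesPresentation k G).toRingHom.codRestrict _ (reesPresentation_mem k G))

/-- A degree count: the coefficient of `t^j` is homogeneous of degree `n * j`, whereas `𝔪 J^j` lies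
in `𝔪 ^ (n * j + 1)`. -/
theorem fiberPresentation_eq_zero_iff (p : MvPolynomial (VertexCover G) k) :
    fiberPresentation k G p = 0 ↔ reesPresentation k G p = 0 := by
  rw [fiberPresentation, RingHom.comp_apply, Ideal.Quotient.eq_zero_iff_mem]
  constructor
  · intro h
    ext1 j
    refine (isHomogeneous_coeff_reesPresentation k G p j).eq_zero_of_mem_pow_idealOfVars
      (Nat.lt_succ_self _) ?_
    rw [pow_succ', pow_mul]
    exact Ideal.mul_mono_right (Ideal.pow_right_mono (coverIdeal_whiskering_le k G) j) (h j)
  · intro h j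
    change (reesPresentation k G p).coeff j ∈ _
    rw [h]
    exact zero_mem _

theorem fiberPresentation_surjective : Function.Surjective (fiberPresentation k G) := by
  set J := coverIdeal k (whiskering G) with hJ
  set S := (fiberPresentation k G).range with hS
  have hC (r : MvPolynomial (V ⊕ V) k) :
      Ideal.Quotient.mk (fiberIdeal J) (algebraMap _ (reesAlgebra J) r) ∈ S := by
    -- Modulo `𝔪`, a scalar `r` equals its constant term.
    refine ⟨C (constantCoeff r), ?_⟩
    rw [fiberPresentation, RingHom.comp_apply, Ideal.Quotient.eq]
    intro j
    change (reesPresentation k G (C (constantCoeff r)) - Polynomial.C r).coeff j ∈ _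
    rw [← algebraMap_eq, AlgHom.commutes, IsScalarTower.algebraMap_apply k
      (MvPolynomial (V ⊕ V) k), Polynomial.algebraMap_eq, ← Polynomial.C_sub, Polynomial.coeff_C]
    split_ifs with h
    · subst h
      rw [pow_zero, Ideal.one_eq_top, Ideal.mul_top, ← pow_one (idealOfVars _ _),
        mem_pow_idealOfVars_iff']
      intro x hx
      obtain rfl : x = 0 := by simpa [Finsupp.degree_eq_zero_iff] using hx
      simp [constantCoeff_eq]
    · exact zero_mem _
  have hmon (f : MvPolynomial (V ⊕ V) k) (hf : f ∈ J) :
      ∃ h : Polynomial.monomial 1 f ∈ reesAlgebra J,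
        Ideal.Quotient.mk (fiberIdeal J) ⟨_, h⟩ ∈ S := by
    rw [hJ, coverIdeal_whiskering_eq_span] at hf
    induction hf using Submodule.span_induction with
    | mem f hf =>
      obtain ⟨C, rfl⟩ := hf
      refine ⟨?_, X C, ?_⟩
      · rw [reesAlgebra.monomial_mem, pow_one]
        exact whiskerMonomial_mem_coverIdeal k G C
      · rw [fiberPresentation, RingHom.comp_apply]
        congr 1
        ext1
        exact aeval_X _ _
    | zero =>
      rw [map_zero]
      exact ⟨zero_mem _, zero_mem S⟩
    | add f g _ _ hf hg =>
      obtain ⟨hf, hf'⟩ := hf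
      obtain ⟨hg, hg'⟩ := hg
      rw [map_add]
      exact ⟨add_mem hf hg, add_mem hf' hg'⟩
    | smul a f _ hf =>
      obtain ⟨hf, hf'⟩ := hf
      rw [smul_eq_mul, ← Polynomial.C_mul_monomial]
      exact ⟨mul_mem (Subalgebra.algebraMap_mem _ a) hf, mul_mem (hC a) hf'⟩
  rw [← RingHom.range_eq_top, ← hS, eq_top_iff]
  rintro x -
  obtain ⟨⟨x, hx⟩, rfl⟩ := Ideal.Quotient.mk_surjective x
  have hx' := hx
  rw [← adjoin_monomial_eq_reesAlgebra] at hx'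
  have key : ∃ h : x ∈ reesAlgebra J, Ideal.Quotient.mk (fiberIdeal J) ⟨x, h⟩ ∈ S := by
    clear hx
    induction hx' using Algebra.adjoin_induction with
    | mem x hx =>
      obtain ⟨f, hf, rfl⟩ := hx
      exact hmon f hf
    | algebraMap r => exact ⟨_, hC r⟩
    | add x y _ _ hx hy =>
      obtain ⟨hx, hx'⟩ := hx
      obtain ⟨hy, hy'⟩ := hy
      exact ⟨add_mem hx hy, add_mem hx' hy'⟩
    | mul x y _ _ hx hy =>
      obtain ⟨hx, hx'⟩ := hx
      obtain ⟨hy, hy'⟩ := hy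
      exact ⟨mul_mem hx hy, mul_mem hx' hy'⟩
  exact key.2

/-! ### Dehomogenization and dimension -/

/-- The toric parametrization `z_C ↦ T ∏_{i ∈ C} a_i`, where `T = X none` and
`a_i = X (some i)`. -/
noncomputable def toricPresentation : MvPolynomial (VertexCover G) k →ₐ[k] MvPolynomial (Option V) k :=
  aeval fun C => X none * ∏ i ∈ C.1, X (some i)

theorem toricPresentation_eq_zero_iff (p : MvPolynomial (VertexCover G) k) :
    toricPresentation k G p = 0 ↔ reesPresentation k G p = 0 := by
  classical
  constructor
  · intro h
    let K := FractionRing (MvPolynomial (V ⊕ V) k)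
    let ι : MvPolynomial (V ⊕ V) k →ₐ[k] K := IsScalarTower.toAlgHom k _ K
    have hι : Function.Injective ι := IsFractionRing.injective _ K
    -- The substitution `T ↦ t ∏ y_i`, `a_i ↦ x_i / y_i`.
    let χ : MvPolynomial (Option V) k →ₐ[k] Polynomial K := aeval fun o => o.elim
      (Polynomial.monomial 1 (∏ i, ι (X (Sum.inr i))))
      fun i => Polynomial.C (ι (X (Sum.inl i)) / ι (X (Sum.inr i)))
    have hcomp : (Polynomial.mapAlgHom ι).comp (reesPresentation k G) =
        χ.comp (toricPresentation k G) := by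
      ext1 C
      simp only [AlgHom.comp_apply, reesPresentation, toricPresentation, aeval_X, map_mul,
        map_prod, χ, Option.elim_none, Option.elim_some, ← Polynomial.C_mul_X_pow_eq_monomial,
        Polynomial.coe_mapAlgHom, Polynomial.map_C, Polynomial.map_pow,
        Polynomial.map_X, AlgHom.coe_toRingHom, whiskerMonomial]
      rw [mul_right_comm]
      congr 1
      simp only [← map_prod Polynomial.C]
      rw [← map_mul Polynomial.C, ← Finset.prod_ite_mem_eq C.1,
        ← Finset.prod_mul_distrib]
      refine congrArg (Polynomial.C : K →+* Polynomial K) (Finset.prod_congr rfl fun i _ => ?_)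
      have : ι (X (Sum.inr i)) ≠ 0 := (map_ne_zero_iff _ hι).mpr (X_ne_zero _)
      split_ifs
      · exact (mul_div_cancel₀ _ this).symm
      · simp
    have h2 := DFunLike.congr_fun hcomp p
    rw [AlgHom.comp_apply, AlgHom.comp_apply, h, map_zero] at h2
    exact (map_eq_zero_iff _ (Polynomial.map_injective _ hι)).mp h2
  · intro h
    -- Conversely, set `x_i = a_i`, `y_i = 1`, `t = T`.
    let φ : MvPolynomial (V ⊕ V) k →ₐ[k] MvPolynomial (Option V) k :=
      aeval (Sum.elim (fun i => X (some i)) fun _ => 1)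
    let χ : Polynomial (MvPolynomial (V ⊕ V) k) →+* MvPolynomial (Option V) k :=
      Polynomial.eval₂RingHom φ.toRingHom (X none)
    have hcomp : χ.comp (reesPresentation k G).toRingHom =
        (toricPresentation k G).toRingHom := by
      refine ringHom_ext (fun a => ?_) fun C => ?_
      · rw [← algebraMap_eq]
        simp [χ]
      · have hφ : φ (whiskerMonomial k C.1) = ∏ i ∈ C.1, X (some i) := by
          rw [whiskerMonomial, map_prod, ← Finset.prod_ite_mem_eq C.1]
          refine Finset.prod_congr rfl fun i _ => ?_
          split_ifs <;> simp [φ]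
        simp [χ, reesPresentation, toricPresentation, hφ, mul_comm]
    have h2 := DFunLike.congr_fun hcomp p
    simp only [RingHom.comp_apply, AlgHom.toRingHom_eq_coe, RingHom.coe_coe, h, map_zero] at h2
    exact h2.symm

/-- Since `G` has no loops, `V ∖ {i}` is a cover. Cancelling its generator from that of `V` yields
`a_i`; cancelling all `a_i` then yields `T`. -/
theorem isAlgebraic_toricPresentation_range :
    Algebra.IsAlgebraic (toricPresentation k G).range (MvPolynomial (Option V) k) := by
  classical
  set B := (toricPresentation k G).range
  set A := Subalgebra.algebraicClosure B (MvPolynomial (Option V) k)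
  have hB (C : VertexCover G) :
      IsAlgebraic B (X none * ∏ i ∈ C.1, X (some i) : MvPolynomial (Option V) k) := by
    have : X none * ∏ i ∈ C.1, X (some i) ∈ B := ⟨X C, by simp [toricPresentation]⟩
    exact isAlgebraic_algebraMap (⟨_, this⟩ : B)
  have htop : IsAlgebraic B (X none * ∏ i, X (some i) : MvPolynomial (Option V) k) :=
    hB ⟨Finset.univ, by simp⟩
  have herase (i : V) :
      IsAlgebraic B (X none * ∏ j ∈ Finset.univ.erase i, X (some j) :
        MvPolynomial (Option V) k) := by
    refine hB ⟨Finset.univ.erase i, fun u v huv => ?_⟩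
    have := huv.ne
    simp only [Finset.coe_erase, Finset.coe_univ, Set.mem_sdiff, Set.mem_univ, true_and,
      Set.mem_singleton_iff]
    grind
  have hprod {s : Finset V} : (∏ i ∈ s, X (some i) : MvPolynomial (Option V) k) ≠ 0 :=
    Finset.prod_ne_zero_iff.mpr fun _ _ => X_ne_zero _
  have hsome (i : V) : IsAlgebraic B (X (some i) : MvPolynomial (Option V) k) := by
    refine .of_mul (y := X none * ∏ j ∈ Finset.univ.erase i, X (some j))
      (mem_nonZeroDivisors_of_ne_zero (mul_ne_zero (X_ne_zero _) hprod)) (herase i) ?_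
    rw [mul_assoc, Finset.prod_erase_mul _ _ (Finset.mem_univ i)]
    exact htop
  have hnone : IsAlgebraic B (X none : MvPolynomial (Option V) k) := by
    refine .of_mul (y := ∏ i, X (some i)) (mem_nonZeroDivisors_of_ne_zero hprod)
      (prod_mem (S := A) fun i _ => hsome i) ?_
    rw [mul_comm]
    exact htop
  refine ⟨fun p => ?_⟩
  change p ∈ A
  induction p using MvPolynomial.induction_on with
  | C a => exact A.algebraMap_mem (algebraMap k B a)
  | add p q hp hq => exact add_mem hp hq
  | mul_X p o hp => exact mul_mem hp (by cases o; exacts [hnone, hsome _])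

theorem ringKrullDim_toricPresentation_range :
    ringKrullDim (toricPresentation k G).range = ((Fintype.card V + 1 : ℕ) : WithBot ℕ∞) := by
  have := isAlgebraic_toricPresentation_range k G
  have : Algebra.FiniteType k (toricPresentation k G).range :=
    .of_surjective (toricPresentation k G).rangeRestrict
      (toricPresentation k G).rangeRestrict_surjective
  apply ringKrullDim_eq_of_trdeg_eq k
  have h := trdeg_add_eq k (toricPresentation k G).range (A := MvPolynomial (Option V) k)
  rw [trdeg_eq_zero (R := (toricPresentation k G).range), add_zero, MvPolynomial.trdeg_of_isDomain] at h
  simpa using h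

end Whiskering

theorem mainTheorem8 {k : Type*} [Field k] {V : Type*} [Fintype V] (G : SimpleGraph V)
    (n : ℕ) (hn : Fintype.card V = n) :
    analyticSpread (coverIdeal k (whiskering G)) = ((n + 1 : ℕ) : WithBot ℕ∞) := by
  subst hn
  rw [← ringKrullDim_toricPresentation_range k G, analyticSpread]
  have hker : RingHom.ker (fiberPresentation k G) = RingHom.ker (toricPresentation k G) := by
    ext p
    rw [RingHom.mem_ker, RingHom.mem_ker, fiberPresentation_eq_zero_iff,
      toricPresentation_eq_zero_iff]
  exact ringKrullDim_eq_of_ringEquiv <|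
    (RingHom.quotientKerEquivOfSurjective (fiberPresentation_surjective k G)).symm.trans <|
      (Ideal.quotEquivOfEq hker).trans
        (Ideal.quotientKerEquivRange (toricPresentation k G)).toRingEquiv
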